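/- All graphs are finite and simple. For graphs $H$ and $F$ and an integer $m \ge 0$, let $\mathrm{mex}(m,H,F)$ denote the maximum number of copies of $H$ (not necessarily induced subgraphs isomorphic to $H$) in a graph with exactly $m$ edges, and any number of vertices, that contains no copy of $F$ as a subgraph. Let $K_{s_1,s_2,s_3}$ be the complete tripartite graph with parts of sizes $s_1,s_2,s_3$. Let $s_1 \le s_2 \le s_3$ be fixed positive integers. Then, as $m \to \infty$, $$\mathrm{mex}(m,K_3,K_{s_1,s_2,s_3}) = o\!\left(m^{\frac32-\frac{1}{8s_1s_2-2}}\right).$$ If moreover $\frac{s_1s_2+s_2s_3+s_3s_1}{s_1+s_2+s_3} > \frac32$, then also $$\mathrm{mex}(m,K_3,K_{s_1,s_2,s_3}) = \Omega\!\left(m^{\frac32-\frac{3(s_1+s_2+s_3)-6}{4(s_1s_2+s_2s_3+s_3s_1)-2(s_1+s_2+s_3)-8}}\right),$$ that is, there is a constant $c>0$ (depending on $s_1,s_2,s_3$) such that $\mathrm{mex}(m,K_3,K_{s_1,s_2,s_3})$ is at least $c$ times the displayed power of $m$ for all sufficiently large $m$. -/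

import Mathlib

open Filter Asymptotics

/-- The numbers of (unlabelled, not necessarily induced) copies of `H` in `G`, where `G` runs over
the finite simple graphs with exactly `m` edges that contain no copy of `F`. The number of vertices
of `G` is not restricted. -/
def mexSet {α β : Type*} (m : ℕ) (H : SimpleGraph α) (F : SimpleGraph β) : Set ℕ :=
  {k | ∃ (V : Type) (_ : Fintype V) (G : SimpleGraph V),
    G.edgeSet.ncard = m ∧ F.Free G ∧ G.copyCount H = k}

/-- `mex m H F` is the maximum number of copies of `H` in an `F`-free graph with `m` edges. -/
noncomputable def mex {α β : Type*} (m : ℕ) (H : SimpleGraph α) (F : SimpleGraph β) : ℕ :=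
  sSup (mexSet m H F)

/-- The complete tripartite graph with parts of sizes `a`, `b`, `c`. -/
abbrev completeTripartite (a b c : ℕ) : SimpleGraph (Σ i : Fin 3, Fin (![a, b, c] i)) :=
  SimpleGraph.completeMultipartiteGraph fun i => Fin (![a, b, c] i)

/-- If `H` has no isolated vertex, then a graph with `m` edges has at most `2 ^ m` copies of `H`. -/
theorem mexSet_bddAbove {α β : Type*} (m : ℕ) (H : SimpleGraph α) (F : SimpleGraph β)
    (hH : ∀ v, ∃ w, H.Adj v w) : BddAbove (mexSet m H F) := by
  classical
  refine ⟨2 ^ m, ?_⟩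
  rintro k ⟨V, _, G, hm, -, rfl⟩
  have hcard : G.edgeFinset.card = m := by
    rw [← hm, ← SimpleGraph.coe_edgeFinset, Set.ncard_coe_finset]
  rw [← hcard, ← Finset.card_powerset, SimpleGraph.copyCount]
  refine Finset.card_le_card_of_injOn (fun G' => G.edgeFinset.filter (· ∈ G'.edgeSet)) ?_ ?_
  · intro G' _
    simp
  · intro A hA B hB hAB
    have key : ∀ C : G.Subgraph, Nonempty (H ≃g C.coe) → ∀ v ∈ C.verts, ∃ w, C.Adj v w := by
      rintro C ⟨e⟩ v hv
      obtain ⟨w, hw⟩ := hH (e.symm ⟨v, hv⟩)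
      refine ⟨e w, ?_⟩
      have := e.map_rel_iff.2 hw
      simpa using this
    have hadj : ∀ v w, A.Adj v w ↔ B.Adj v w := by
      intro v w
      have h := Finset.ext_iff.1 hAB s(v, w)
      simp only [Finset.mem_filter, SimpleGraph.mem_edgeFinset, SimpleGraph.mem_edgeSet,
        SimpleGraph.Subgraph.mem_edgeSet] at h
      exact ⟨fun h1 => (h.1 ⟨h1.adj_sub, h1⟩).2, fun h1 => (h.2 ⟨h1.adj_sub, h1⟩).2⟩
    have hA' := key A (by simpa using hA)
    have hB' := key B (by simpa using hB)
    refine SimpleGraph.Subgraph.ext ?_ ?_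
    · ext v
      constructor
      · intro hv
        obtain ⟨w, hw⟩ := hA' v hv
        exact ((hadj v w).1 hw).fst_mem
      · intro hv
        obtain ⟨w, hw⟩ := hB' v hv
        exact ((hadj v w).2 hw).fst_mem
    · ext v w
      exact hadj v w

/-- For the graphs considered here the supremum in `mex` is a maximum. -/
theorem isGreatest_mex_completeTripartite (m a b c : ℕ) (ha : 0 < a) (hb : 0 < b) (hc : 0 < c) :
    IsGreatest (mexSet m (⊤ : SimpleGraph (Fin 3)) (completeTripartite a b c))
      (mex m (⊤ : SimpleGraph (Fin 3)) (completeTripartite a b c)) := by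
  have hbdd := mexSet_bddAbove m (⊤ : SimpleGraph (Fin 3)) (completeTripartite a b c)
    (fun v => ⟨v + 1, by fin_cases v <;> simp⟩)
  refine ⟨Nat.sSup_mem ?_ hbdd, fun k hk => le_csSup hbdd hk⟩
  refine ⟨_, Fin 1 ⊕ Fin m, inferInstance, completeBipartiteGraph (Fin 1) (Fin m), ?_, ?_, rfl⟩
  · rw [Set.ncard, SimpleGraph.encard_edgeSet_completeBipartiteGraph]
    simp
  · rintro ⟨f⟩
    have hpos : ∀ i : Fin 3, 0 < ![a, b, c] i := by
      intro i
      fin_cases i <;> simp [ha, hb, hc]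
    have col := SimpleGraph.CompleteBipartiteGraph.bicoloring (Fin 1) (Fin m)
    let g : Fin 3 → Bool := fun i => col (f ⟨i, ⟨0, hpos i⟩⟩)
    have hg : Function.Injective g := by
      intro i j hij
      by_contra hne
      refine col.valid (f.toHom.map_adj (v := ⟨i, ⟨0, hpos i⟩⟩) (w := ⟨j, ⟨0, hpos j⟩⟩) ?_) hij
      simpa using hne
    have := Fintype.card_le_of_injective g hg
    simp at this

/-!
Let `F = K_{a,b,c}`, `t = a * b`, and let `v` and `e` be the numbers of vertices and edges of `F`.

**Upper bound.** An `F`-free graph on `n` vertices has `o(n ^ (3 - 1 / t))` triangles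
(`SimpleGraph.card_triangles_le_of_free`). To see this, let `G' ≤ G` and let `τ` be the density of
the triples `(x, y, z)` that form a triangle of `G` with `xy ∈ G'`. By convexity there are at least
`n ^ (a + b + 1) * τ ^ t` pairs of a homomorphism `K_{a,b} → G'` and a common neighbour `z` in `G` of
its image. As `G` is `F`-free, an injective homomorphism has fewer than `c` such common neighbours, so
`n * τ ^ t` is at most a constant times the edge density of `G'`, up to an error from non-injective
homomorphisms that is proportional to `τ` (`SimpleGraph.card_mul_density_pow_le`). With `G' = G` this
shows `τ → 0`. Hence, by the triangle removal lemma, all triangles of `G` can be destroyed by deleting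
a set of `o(n ^ 2)` edges, and the same inequality with this set as `G'` gives the claim.

For a graph with `m` edges, fix a threshold `D`. The triangles with a vertex of degree below `D`
number at most `2 * m * D`, and the remaining ones live on at most `2 * m / D` vertices. A small
multiple of `m ^ ((2 * t - 1) / (4 * t - 1))` is the optimal threshold `D`
(`SimpleGraph.eventually_card_triangles_le`).

**Lower bound.** Take a uniformly random set of `m` edges of the complete graph on `n` vertices and
delete one edge from each copy of `F`. A deleted edge destroys at most `n` triangles, so this leaves a
constant proportion of the expected number of triangles as soon as
`n ^ (v + 1) * (m / n ^ 2) ^ e` is at most a small multiple of `n ^ 3 * (m / n ^ 2) ^ 3`, i.e. if `n`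
is a large multiple of `m ^ ((e - 3) / (2 * e - v - 4))`. The number of triangles is then of order
`m ^ 3 / n ^ 3` (`SimpleGraph.exists_free_card_edgeFinset_le`, `SimpleGraph.cube_le_mul_mex`). A
disjoint star brings the number of edges back to `m` without creating a copy of `F`
(`SimpleGraph.numTriangles_le_mex`).
-/

/-! ### Homomorphic images of complete bipartite graphs in links -/

namespace SimpleGraph

section Counting

open Classical Finset

variable {V : Type*} [Fintype V]

/-- The ordered triangles `(x, y, z)` of `G` whose edge `xy` belongs to `G'`. -/
noncomputable def markedTriangles (G G' : SimpleGraph V) : Finset (V × V × V) :=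
  {t | G'.Adj t.1 t.2.1 ∧ G.Adj t.1 t.2.2 ∧ G.Adj t.2.1 t.2.2}

theorem mem_markedTriangles {G G' : SimpleGraph V} {x y z : V} :
    (x, y, z) ∈ markedTriangles G G' ↔ G'.Adj x y ∧ G.Adj x z ∧ G.Adj y z := by
  simp [markedTriangles]

/-- The triples `(X, Y, z)` such that `X`, `Y` is a homomorphic image of `K_{a,b}` in the part of
`G'` lying in the neighbourhood of `z` in `G`. The maps `X` and `Y` need not be injective. -/
noncomputable def linkHoms (G G' : SimpleGraph V) (a b : ℕ) :
    Finset ((Fin a → V) × (Fin b → V) × V) :=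
  {p | ∀ i j, (p.1 i, p.2.1 j, p.2.2) ∈ markedTriangles G G'}

theorem mem_linkHoms {G G' : SimpleGraph V} {a b : ℕ} {X : Fin a → V} {Y : Fin b → V} {z : V} :
    (X, Y, z) ∈ linkHoms G G' a b ↔ ∀ i j, (X i, Y j, z) ∈ markedTriangles G G' := by
  simp [linkHoms]

/-- The power mean inequality, normalised. -/
theorem card_mul_avg_pow_le_sum_pow {ι : Type*} (s : Finset ι) (f : ι → ℝ) (hf : ∀ i ∈ s, 0 ≤ f i)
    {k : ℕ} (hk : 0 < k) : (#s : ℝ) * ((∑ i ∈ s, f i) / #s) ^ k ≤ ∑ i ∈ s, f i ^ k := by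
  obtain ⟨k, rfl⟩ := Nat.exists_eq_succ_of_ne_zero hk.ne'
  rcases s.eq_empty_or_nonempty with rfl | hs
  · simp
  refine le_trans (le_of_eq ?_) (pow_sum_div_card_le_sum_pow hf k)
  have : (#s : ℝ) ≠ 0 := by simpa using hs.ne_empty
  rw [div_pow, Nat.succ_eq_add_one]
  field_simp
  ring

/-- The weighted form of the statement that, among graphs of given density, random graphs minimise
the number of homomorphic images of `K_{a,b}`. -/
theorem card_pow_mul_density_pow_le_sum_prod [Nonempty V] (w : V → V → ℝ)
    (hw : ∀ x y, 0 ≤ w x y) {a b : ℕ} (ha : 0 < a) (hb : 0 < b) :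
    (Fintype.card V : ℝ) ^ (a + b) *
        ((∑ x, ∑ y, w x y) / (Fintype.card V : ℝ) ^ 2) ^ (a * b) ≤
      ∑ X : Fin a → V, ∑ Y : Fin b → V, ∏ i, ∏ j, w (X i) (Y j) := by
  set n : ℝ := ((Fintype.card V : ℕ) : ℝ) with hn
  have hn0 : 0 < n := by rw [hn]; exact_mod_cast Fintype.card_pos
  have h1 : n * ((∑ x, ∑ y, w x y) / n) ^ a ≤ ∑ y, (∑ x, w x y) ^ a := by
    rw [sum_comm]
    simpa [hn] using card_mul_avg_pow_le_sum_pow univ (fun y => ∑ x, w x y)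
      (fun y _ => sum_nonneg fun x _ => hw x y) ha
  have h2 : ∑ y, (∑ x, w x y) ^ a = ∑ X : Fin a → V, ∑ y, ∏ i, w (X i) y := by
    rw [sum_comm]
    refine sum_congr rfl fun y _ => ?_
    rw [Fintype.sum_pow]
  have h3 : ∀ X : Fin a → V, ∑ Y : Fin b → V, ∏ i, ∏ j, w (X i) (Y j) =
      (∑ y, ∏ i, w (X i) y) ^ b := by
    intro X
    rw [Fintype.sum_pow]
    exact sum_congr rfl fun Y _ => prod_comm
  have h4 := card_mul_avg_pow_le_sum_pow (univ : Finset (Fin a → V))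
    (fun X => ∑ y, ∏ i, w (X i) y)
    (fun X _ => sum_nonneg fun y _ => prod_nonneg fun i _ => hw _ _) hb
  have hcard : ((#(univ : Finset (Fin a → V)) : ℕ) : ℝ) = n ^ a := by simp [hn]
  rw [hcard, ← h2] at h4
  simp_rw [h3]
  refine le_trans ?_ h4
  have hS : 0 ≤ ∑ x, ∑ y, w x y := sum_nonneg fun x _ => sum_nonneg fun y _ => hw x y
  calc n ^ (a + b) * ((∑ x, ∑ y, w x y) / n ^ 2) ^ (a * b)
      = n ^ a * ((n * ((∑ x, ∑ y, w x y) / n) ^ a) / n ^ a) ^ b := by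
        rw [pow_mul, pow_add, mul_assoc, ← mul_pow]
        congr 2
        rw [div_pow, div_pow, ← pow_mul, mul_comm 2 a, pow_mul]
        field_simp
    _ ≤ _ := by gcongr

/-- Averaging over the apex `z`, `linkHoms` has at least as many elements as for a random set of
ordered triangles of the same density. -/
theorem card_pow_mul_density_pow_le_card_linkHoms [Nonempty V] (G G' : SimpleGraph V) {a b : ℕ}
    (ha : 0 < a) (hb : 0 < b) :
    (Fintype.card V : ℝ) ^ (a + b + 1) *
        ((#(markedTriangles G G') : ℝ) / (Fintype.card V : ℝ) ^ 3) ^ (a * b) ≤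
      #(linkHoms G G' a b) := by
  set n : ℝ := ((Fintype.card V : ℕ) : ℝ) with hn
  have hn0 : 0 < n := by rw [hn]; exact_mod_cast Fintype.card_pos
  let w : V → V → V → ℝ := fun z x y => if (x, y, z) ∈ markedTriangles G G' then 1 else 0
  have hw : ∀ z x y, 0 ≤ w z x y := fun z x y => by simp only [w]; split_ifs <;> norm_num
  have hcount : (#(linkHoms G G' a b) : ℝ) =
      ∑ z, ∑ X : Fin a → V, ∑ Y : Fin b → V, ∏ i, ∏ j, w z (X i) (Y j) := by
    rw [linkHoms, card_filter]
    push_cast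
    simp_rw [Fintype.sum_prod_type, w, prod_boole, mem_univ, true_imp_iff]
    rw [sum_comm_cycle]
    refine sum_congr rfl fun z _ => sum_congr rfl fun X _ => sum_congr rfl fun Y _ => ?_
    by_cases h : ∀ i j, (X i, Y j, z) ∈ markedTriangles G G'
    · simp [h]
    · obtain ⟨i, hi⟩ := not_forall.1 h
      rw [if_neg h, prod_eq_zero (mem_univ i) (if_neg hi)]
  have htri : (#(markedTriangles G G') : ℝ) = ∑ z, ∑ x, ∑ y, w z x y := by
    rw [markedTriangles, card_filter]
    push_cast
    simp_rw [Fintype.sum_prod_type, w, mem_markedTriangles]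
    rw [sum_comm_cycle]
  rw [hcount, htri]
  have hz := sum_le_sum fun z (_ : z ∈ univ) =>
    card_pow_mul_density_pow_le_sum_prod (w z) (hw z) ha hb
  refine le_trans ?_ hz
  rw [← mul_sum]
  have h5 := card_mul_avg_pow_le_sum_pow (univ : Finset V)
    (fun z => (∑ x, ∑ y, w z x y) / n ^ 2)
    (fun z _ => div_nonneg (sum_nonneg fun x _ => sum_nonneg fun y _ => hw z x y) (by positivity))
    (mul_pos ha hb)
  rw [card_univ, ← hn, ← sum_div] at h5
  rw [pow_succ, mul_assoc]
  refine mul_le_mul_of_nonneg_left (le_trans (le_of_eq ?_) h5) (by positivity)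
  congr 2
  field_simp

/-- Few elements of `linkHoms` are degenerate in the first coordinate. -/
theorem card_linkHoms_degenerate_left_le (G G' : SimpleGraph V) (a b : ℕ) (hb : 0 < b) :
    Fintype.card V ^ 3 * #{p ∈ linkHoms G G' a b | ¬ Function.Injective p.1} ≤
      a ^ 2 * (#(markedTriangles G G') * Fintype.card V ^ (a + b)) := by
  have hsub : {p ∈ linkHoms G G' a b | ¬ Function.Injective p.1} ⊆
      (univ : Finset (Fin a × Fin a)).biUnion fun ij =>
        {p ∈ linkHoms G G' a b | p.1 ij.1 = p.1 ij.2 ∧ ij.1 ≠ ij.2} := by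
    intro p hp
    simp only [mem_filter, Function.Injective, not_forall] at hp
    obtain ⟨hp, i, j, h, hij⟩ := hp
    exact mem_biUnion.2 ⟨(i, j), mem_univ _, mem_filter.2 ⟨hp, h, hij⟩⟩
  have hone : ∀ ij : Fin a × Fin a, Fintype.card V ^ 3 *
      #{p ∈ linkHoms G G' a b | p.1 ij.1 = p.1 ij.2 ∧ ij.1 ≠ ij.2} ≤
        #(markedTriangles G G') * Fintype.card V ^ (a + b) := by
    rintro ⟨i, j⟩
    let j₀ : Fin b := ⟨0, hb⟩
    -- Overwriting `X i`, `X j` and `Y j₀` loses only the triangle `(X i, Y j₀, z)`, as `X j = X i`.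
    have := card_le_card_of_injOn
      (s := (univ : Finset (V × V × V)) ×ˢ
        {p ∈ linkHoms G G' a b | p.1 i = p.1 j ∧ i ≠ j})
      (t := markedTriangles G G' ×ˢ (univ : Finset ((Fin a → V) × (Fin b → V))))
      (fun q => ((q.2.1 i, q.2.2.1 j₀, q.2.2.2),
        (Function.update (Function.update q.2.1 i q.1.1) j q.1.2.1,
          Function.update q.2.2.1 j₀ q.1.2.2)))
      (by
        rintro ⟨u, p⟩ hp
        simp only [coe_product, Set.mem_prod, mem_coe, mem_filter, mem_univ, true_and] at hp ⊢
        exact ⟨(mem_linkHoms.1 hp.1) i j₀, trivial⟩)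
      (by
        rintro ⟨⟨u, v, w⟩, X, Y, z⟩ hp ⟨⟨u', v', w'⟩, X', Y', z'⟩ hp' h
        simp only [coe_product, Set.mem_prod, mem_coe, mem_filter, mem_univ, true_and] at hp hp'
        obtain ⟨-, hX, hij⟩ := hp
        obtain ⟨-, hX', -⟩ := hp'
        simp only [Prod.mk.injEq] at h
        obtain ⟨⟨h1, h2, rfl⟩, h3, h4⟩ := h
        have hu := congrFun h3 i
        have hv := congrFun h3 j
        have hw := congrFun h4 j₀
        simp only [Function.update_self, Function.update_of_ne hij] at hu hv hw
        subst hu hv hw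
        have hXX : X = X' := by
          funext k
          by_cases hki : k = i
          · rw [hki, h1]
          by_cases hkj : k = j
          · rw [hkj, ← hX, ← hX', h1]
          simpa [hki, hkj] using congrFun h3 k
        have hYY : Y = Y' := by
          funext k
          by_cases hk : k = j₀
          · rw [hk, h2]
          simpa [hk] using congrFun h4 k
        rw [hXX, hYY])
    rw [card_product, card_product] at this
    simp only [card_univ, Fintype.card_prod, Fintype.card_pi, prod_const, Fintype.card_fin] at this
    rw [pow_add, pow_three]
    exact this
  calc Fintype.card V ^ 3 * #{p ∈ linkHoms G G' a b | ¬ Function.Injective p.1}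
      ≤ Fintype.card V ^ 3 * ∑ ij : Fin a × Fin a,
          #{p ∈ linkHoms G G' a b | p.1 ij.1 = p.1 ij.2 ∧ ij.1 ≠ ij.2} :=
        Nat.mul_le_mul_left _ ((card_le_card hsub).trans card_biUnion_le)
    _ ≤ ∑ ij : Fin a × Fin a, #(markedTriangles G G') * Fintype.card V ^ (a + b) := by
        rw [mul_sum]; exact sum_le_sum fun ij _ => hone ij
    _ = _ := by simp [sq]

theorem card_linkHoms_degenerate_right_le (G G' : SimpleGraph V) (a b : ℕ) (ha : 0 < a) :
    Fintype.card V ^ 3 * #{p ∈ linkHoms G G' a b | ¬ Function.Injective p.2.1} ≤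
      b ^ 2 * (#(markedTriangles G G') * Fintype.card V ^ (a + b)) := by
  rw [add_comm a b]
  refine le_trans (Nat.mul_le_mul_left _ ?_) (card_linkHoms_degenerate_left_le G G' b a ha)
  refine card_le_card_of_injOn (fun p => (p.2.1, p.1, p.2.2)) ?_ ?_
  · rintro ⟨X, Y, z⟩ hp
    simp only [coe_filter, Set.mem_ofPred_eq, mem_linkHoms, mem_markedTriangles] at hp ⊢
    exact ⟨fun i j => ⟨(hp.1 j i).1.symm, (hp.1 j i).2.2, (hp.1 j i).2.1⟩, hp.2⟩
  · rintro ⟨X, Y, z⟩ - ⟨X', Y', z'⟩ - h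
    simp only [Prod.mk.injEq] at h ⊢
    exact ⟨h.2.1, h.1, h.2.2⟩

/-- Three injective families that are pairwise completely joined span a complete tripartite
graph. -/
theorem completeTripartite_isContained {V : Type*} {G : SimpleGraph V} {a b c : ℕ} (X : Fin a → V)
    (Y : Fin b → V) (Z : Fin c → V) (hX : Function.Injective X) (hY : Function.Injective Y)
    (hZ : Function.Injective Z) (hXY : ∀ i j, G.Adj (X i) (Y j)) (hXZ : ∀ i k, G.Adj (X i) (Z k))
    (hYZ : ∀ j k, G.Adj (Y j) (Z k)) : completeTripartite a b c ⊑ G := by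
  let f : (Σ i : Fin 3, Fin (![a, b, c] i)) → V := fun p =>
    match p with
    | ⟨0, k⟩ => X k
    | ⟨1, k⟩ => Y k
    | ⟨2, k⟩ => Z k
  have hadj : ∀ p q, (completeTripartite a b c).Adj p q → G.Adj (f p) (f q) := by
    rintro ⟨i, p⟩ ⟨j, q⟩ h
    have hij : i ≠ j := by simpa using h
    fin_cases i <;> fin_cases j
    · exact absurd rfl hij
    · exact hXY _ _
    · exact hXZ _ _
    · exact (hXY _ _).symm
    · exact absurd rfl hij
    · exact hYZ _ _
    · exact (hXZ _ _).symm
    · exact (hYZ _ _).symm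
    · exact absurd rfl hij
  refine ⟨⟨⟨f, fun {p q} h => hadj p q h⟩, ?_⟩⟩
  rintro ⟨i, p⟩ ⟨j, q⟩ h
  by_cases hij : i = j
  · subst hij
    congr 1
    fin_cases i
    · exact hX h
    · exact hY h
    · exact hZ h
  · exact absurd h (hadj ⟨i, p⟩ ⟨j, q⟩ (by simpa using hij)).ne

/-- In a graph without `K_{a,b,c}`, a copy of `K_{a,b}` has fewer than `c` common neighbours. -/
theorem card_linkHoms_injective_le {G G' : SimpleGraph V} (hG : G' ≤ G) {a b c : ℕ} (ha : 0 < a)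
    (hb : 0 < b) (hF : (completeTripartite a b c).Free G) :
    Fintype.card V ^ 2 *
        #{p ∈ linkHoms G G' a b | Function.Injective p.1 ∧ Function.Injective p.2.1} ≤
      c * (#{e : V × V | G'.Adj e.1 e.2} * Fintype.card V ^ (a + b)) := by
  let i₀ : Fin a := ⟨0, ha⟩
  let j₀ : Fin b := ⟨0, hb⟩
  have h1 : #{p ∈ linkHoms G G' a b | Function.Injective p.1 ∧ Function.Injective p.2.1} ≤
      c * #{q : (Fin a → V) × (Fin b → V) | G'.Adj (q.1 i₀) (q.2 j₀)} := by
    refine card_le_mul_card_image_of_maps_to (f := fun p => (p.1, p.2.1)) ?_ c ?_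
    · rintro ⟨X, Y, z⟩ hp
      simp only [mem_filter, mem_linkHoms, mem_markedTriangles, mem_univ, true_and] at hp ⊢
      exact (hp.1 i₀ j₀).1
    · rintro ⟨X, Y⟩ -
      by_contra! hlt
      set S := {p ∈ {p ∈ linkHoms G G' a b |
        Function.Injective p.1 ∧ Function.Injective p.2.1} | (p.1, p.2.1) = (X, Y)} with hS
      have hmem : ∀ p ∈ S, p = (X, Y, p.2.2) ∧ Function.Injective X ∧ Function.Injective Y ∧
          ∀ i j, (X i, Y j, p.2.2) ∈ markedTriangles G G' := by
        rintro ⟨X', Y', z⟩ hp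
        simp only [hS, mem_filter, mem_linkHoms, Prod.mk.injEq] at hp
        obtain ⟨⟨h, hX, hY⟩, rfl, rfl⟩ := hp
        exact ⟨rfl, hX, hY, h⟩
      obtain ⟨f⟩ : Nonempty (Fin c ↪ S) := by
        rw [Function.Embedding.nonempty_iff_card_le]
        simpa using hlt.le
      have hZ : ∀ k i j, G'.Adj (X i) (Y j) ∧ G.Adj (X i) (f k).1.2.2 ∧ G.Adj (Y j) (f k).1.2.2 :=
        fun k i j => mem_markedTriangles.1 ((hmem _ (f k).2).2.2.2 i j)
      have hSne : S.Nonempty := card_pos.1 (lt_of_le_of_lt (Nat.zero_le _) hlt)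
      obtain ⟨p, hp⟩ := hSne
      obtain ⟨-, hX, hY, hadj⟩ := hmem p hp
      refine hF (completeTripartite_isContained X Y (fun k => (f k).1.2.2) hX hY ?_
        (fun i j => hG (mem_markedTriangles.1 (hadj i j)).1) (fun i k => (hZ k i j₀).2.1)
        (fun j k => (hZ k i₀ j).2.2))
      intro k l hkl
      apply f.injective
      apply Subtype.ext
      rw [(hmem _ (f k).2).1, (hmem _ (f l).2).1]
      exact congrArg (fun z => (X, Y, z)) hkl
  have h2 : Fintype.card V ^ 2 *
      #{q : (Fin a → V) × (Fin b → V) | G'.Adj (q.1 i₀) (q.2 j₀)} ≤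
        #{e : V × V | G'.Adj e.1 e.2} * Fintype.card V ^ (a + b) := by
    have := card_le_card_of_injOn
      (s := (univ : Finset (V × V)) ×ˢ
        ({q | G'.Adj (q.1 i₀) (q.2 j₀)} : Finset ((Fin a → V) × (Fin b → V))))
      (t := ({e | G'.Adj e.1 e.2} : Finset (V × V)) ×ˢ
        (univ : Finset ((Fin a → V) × (Fin b → V))))
      (fun q => ((q.2.1 i₀, q.2.2 j₀),
        (Function.update q.2.1 i₀ q.1.1, Function.update q.2.2 j₀ q.1.2)))
      (by rintro ⟨u, p⟩ hp; simpa using hp)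
      (by
        rintro ⟨⟨u, v⟩, X, Y⟩ - ⟨⟨u', v'⟩, X', Y'⟩ - h
        simp only [Prod.mk.injEq] at h
        obtain ⟨⟨h1, h2⟩, h3, h4⟩ := h
        have hu := congrFun h3 i₀
        have hv := congrFun h4 j₀
        simp only [Function.update_self] at hu hv
        subst hu hv
        have hXX : X = X' := by
          funext k
          by_cases hk : k = i₀
          · rw [hk, h1]
          simpa [hk] using congrFun h3 k
        have hYY : Y = Y' := by
          funext k
          by_cases hk : k = j₀
          · rw [hk, h2]
          simpa [hk] using congrFun h4 k
        rw [hXX, hYY])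
    rw [card_product, card_product] at this
    simp only [card_univ, Fintype.card_prod, Fintype.card_pi, prod_const, Fintype.card_fin] at this
    rw [pow_add, sq]
    exact this
  calc _ ≤ Fintype.card V ^ 2 *
        (c * #{q : (Fin a → V) × (Fin b → V) | G'.Adj (q.1 i₀) (q.2 j₀)}) :=
        Nat.mul_le_mul_left _ h1
    _ = c * (Fintype.card V ^ 2 *
        #{q : (Fin a → V) × (Fin b → V) | G'.Adj (q.1 i₀) (q.2 j₀)}) := by ring
    _ ≤ _ := Nat.mul_le_mul_left _ h2

/-- The density form of the supersaturation inequality: `τ` is the density of the ordered triangles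
whose first edge lies in `G'`. -/
theorem card_mul_density_pow_le [Nonempty V] {G G' : SimpleGraph V} (hG : G' ≤ G) {a b c : ℕ}
    (ha : 0 < a) (hb : 0 < b) (hF : (completeTripartite a b c).Free G) :
    (Fintype.card V : ℝ) * (#(markedTriangles G G') / (Fintype.card V : ℝ) ^ 3) ^ (a * b) ≤
      c * (#{e : V × V | G'.Adj e.1 e.2} / (Fintype.card V : ℝ) ^ 2) +
        (a ^ 2 + b ^ 2) * (#(markedTriangles G G') / (Fintype.card V : ℝ) ^ 3) := by
  have hlow := card_pow_mul_density_pow_le_card_linkHoms G G' ha hb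
  have h1 := card_linkHoms_degenerate_left_le G G' a b hb
  have h2 := card_linkHoms_degenerate_right_le G G' a b ha
  have h3 := card_linkHoms_injective_le hG ha hb hF
  have hsplit : #(linkHoms G G' a b) ≤
      #{p ∈ linkHoms G G' a b | Function.Injective p.1 ∧ Function.Injective p.2.1} +
        (#{p ∈ linkHoms G G' a b | ¬ Function.Injective p.1} +
          #{p ∈ linkHoms G G' a b | ¬ Function.Injective p.2.1}) := by
    refine le_trans (card_le_card ?_)
      ((card_union_le _ _).trans (Nat.add_le_add_left (card_union_le _ _) _))
    intro p hp
    simp only [mem_union, mem_filter, hp, true_and]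
    tauto
  have h1' : (Fintype.card V : ℝ) ^ 3 * #{p ∈ linkHoms G G' a b | ¬ Function.Injective p.1} ≤
      a ^ 2 * (#(markedTriangles G G') * (Fintype.card V : ℝ) ^ (a + b)) := by exact_mod_cast h1
  have h2' : (Fintype.card V : ℝ) ^ 3 * #{p ∈ linkHoms G G' a b | ¬ Function.Injective p.2.1} ≤
      b ^ 2 * (#(markedTriangles G G') * (Fintype.card V : ℝ) ^ (a + b)) := by exact_mod_cast h2
  have h3' : (Fintype.card V : ℝ) ^ 2 *
      #{p ∈ linkHoms G G' a b | Function.Injective p.1 ∧ Function.Injective p.2.1} ≤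
        c * (#{e : V × V | G'.Adj e.1 e.2} * (Fintype.card V : ℝ) ^ (a + b)) := by
    exact_mod_cast h3
  have hsplit' : (#(linkHoms G G' a b) : ℝ) ≤
      #{p ∈ linkHoms G G' a b | Function.Injective p.1 ∧ Function.Injective p.2.1} +
        (#{p ∈ linkHoms G G' a b | ¬ Function.Injective p.1} +
          #{p ∈ linkHoms G G' a b | ¬ Function.Injective p.2.1}) := by exact_mod_cast hsplit
  have hn0 : (0 : ℝ) < Fintype.card V := by exact_mod_cast Fintype.card_pos
  generalize (Fintype.card V : ℝ) = n at *
  rw [← le_div_iff₀' (by positivity)] at h1' h2' h3'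
  have hp : 0 < n ^ (a + b) := by positivity
  refine le_of_mul_le_mul_left ?_ hp
  calc _ = _ := by rw [← mul_assoc, ← pow_succ]
    _ ≤ _ := hlow
    _ ≤ _ := hsplit'
    _ ≤ _ := add_le_add h3' (add_le_add h1' h2')
    _ = _ := by ring

end Counting

/-! ### Triangles in graphs on a given number of vertices without a complete tripartite graph -/

section Triangles

open Classical Finset

variable {V : Type*} [Fintype V]

/-- The copies of `K₃` are the triangles. -/
theorem copyCount_top_three (G : SimpleGraph V) :
    G.copyCount (⊤ : SimpleGraph (Fin 3)) = #(G.cliqueFinset 3) := by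
  have hadj : ∀ G' : G.Subgraph, Nonempty ((⊤ : SimpleGraph (Fin 3)) ≃g G'.coe) →
      ∀ u v, G'.Adj u v ↔ u ∈ G'.verts ∧ v ∈ G'.verts ∧ u ≠ v := by
    rintro G' ⟨e⟩ u v
    refine ⟨fun h => ⟨h.fst_mem, h.snd_mem, h.ne⟩, fun ⟨hu, hv, huv⟩ => ?_⟩
    have : (⊤ : SimpleGraph (Fin 3)).Adj (e.symm ⟨u, hu⟩) (e.symm ⟨v, hv⟩) := by
      simpa using huv
    simpa using e.map_rel_iff.2 this
  rw [copyCount]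
  refine card_bij (fun G' _ => G'.verts.toFinset) ?_ ?_ ?_
  · intro G' hG'
    have hG'' : Nonempty ((⊤ : SimpleGraph (Fin 3)) ≃g G'.coe) := by simpa using hG'
    rw [mem_cliqueFinset_iff]
    refine ⟨?_, ?_⟩
    · intro u hu v hv huv
      exact ((hadj G' hG'' u v).2 ⟨by simpa using hu, by simpa using hv, huv⟩).adj_sub
    · obtain ⟨e⟩ := hG''
      rw [Set.toFinset_card]
      simpa using (Fintype.card_congr e.toEquiv).symm
  · intro A hA B hB hAB
    have hA' := hadj A (by simpa using hA)
    have hB' := hadj B (by simpa using hB)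
    have hverts : A.verts = B.verts := by simpa using hAB
    refine Subgraph.ext hverts ?_
    ext u v
    rw [hA', hB', hverts]
  · intro s hs
    rw [mem_cliqueFinset_iff] at hs
    refine ⟨(⊤ : G.Subgraph).induce (s : Set V), ?_, by simp⟩
    have e : Fin 3 ≃ ((⊤ : G.Subgraph).induce (s : Set V)).verts :=
      Fintype.equivOfCardEq (by simp [hs.card_eq])
    simp only [mem_filter, mem_univ, true_and]
    refine ⟨⟨e, ?_⟩⟩
    intro i j
    have hi : ((e i : _) : V) ∈ s := by simpa using (e i).2
    have hj : ((e j : _) : V) ∈ s := by simpa using (e j).2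
    simp only [Subgraph.coe_adj, Subgraph.induce_adj, mem_coe, hi, hj, Subgraph.top_adj, true_and,
      top_adj]
    constructor
    · rintro h rfl
      exact h.ne rfl
    · intro h
      exact hs.isClique hi hj fun h' => h (e.injective (Subtype.ext h'))

/-- If deleting the edges of `G'` from `G` leaves no triangle, then every triangle of `G` can be
ordered so that its first edge is in `G'`. -/
theorem card_cliqueFinset_le_card_markedTriangles {G G' : SimpleGraph V}
    (h : (G \ G').CliqueFree 3) : #(G.cliqueFinset 3) ≤ #(markedTriangles G G') := by
  refine card_le_card_of_surjOn (fun t => {t.1, t.2.1, t.2.2}) ?_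
  intro s hs
  rw [coe_cliqueFinset, mem_cliqueSet_iff, is3Clique_iff] at hs
  obtain ⟨x, y, z, hxy, hxz, hyz, rfl⟩ := hs
  by_cases h1 : G'.Adj x y
  · exact ⟨(x, y, z), mem_coe.2 (mem_markedTriangles.2 ⟨h1, hxz, hyz⟩), rfl⟩
  by_cases h2 : G'.Adj x z
  · refine ⟨(x, z, y), mem_coe.2 (mem_markedTriangles.2 ⟨h2, hxy, hyz.symm⟩), ?_⟩
    ext; simp; tauto
  by_cases h3 : G'.Adj y z
  · refine ⟨(y, z, x), mem_coe.2 (mem_markedTriangles.2 ⟨h3, hxy.symm, hxz.symm⟩), ?_⟩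
    ext; simp; tauto
  have hclique : (G \ G').IsNClique 3 {x, y, z} :=
    is3Clique_triple_iff.2 ⟨⟨hxy, h1⟩, ⟨hxz, h2⟩, ⟨hyz, h3⟩⟩
  exact absurd hclique (h _)

/-- The number of ordered pairs of adjacent vertices. -/
theorem card_filter_adj (G : SimpleGraph V) :
    #{e : V × V | G.Adj e.1 e.2} = 2 * #G.edgeFinset := by
  rw [two_mul_card_edgeFinset]

theorem card_filter_adj_sdiff {G G' H : SimpleGraph V} (h : H ≤ G) (hG' : G' = G \ H) :
    (#{e : V × V | G'.Adj e.1 e.2} : ℝ) = 2 * ((#G.edgeFinset : ℝ) - #H.edgeFinset) := by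
  have : #{e : V × V | G'.Adj e.1 e.2} + #{e : V × V | H.Adj e.1 e.2} =
      #{e : V × V | G.Adj e.1 e.2} := by
    rw [← card_union_of_disjoint (s := {e : V × V | G'.Adj e.1 e.2})]
    · congr 1
      ext ⟨x, y⟩
      have := @h x y
      simp only [hG', sdiff_adj, mem_union, mem_filter, mem_univ, true_and]
      tauto
    · rw [Finset.disjoint_left]
      rintro ⟨x, y⟩ h1 h2
      simp only [hG', sdiff_adj, mem_filter, mem_univ, true_and] at h1 h2
      exact h1.2 h2
  rw [card_filter_adj H, card_filter_adj G] at this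
  have h' : (#{e : V × V | G'.Adj e.1 e.2} : ℝ) + 2 * #H.edgeFinset = 2 * #G.edgeFinset := by
    exact_mod_cast this
  linarith

/-- A graph on `n` vertices without `K_{a,b,c}` has `o(n ^ (3 - 1 / (a * b)))` triangles. The power
mean inequality alone gives `O`. By the triangle removal lemma all triangles meet a set of `o(n ^ 2)`
edges, and counting only the copies of `K_{a,b}` within this set gives `o`. -/
theorem card_triangles_le_of_free {a b c : ℕ} (ha : 0 < a) (hb : 0 < b) {ε : ℝ} (hε : 0 < ε) :
    ∃ C : ℝ, ∀ (W : Type) [Fintype W] (G : SimpleGraph W), (completeTripartite a b c).Free G →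
      (#(G.cliqueFinset 3) : ℝ) ≤
        ε * (Fintype.card W : ℝ) ^ ((3 : ℝ) - 1 / ((a : ℝ) * b)) + C := by
  have hab : 0 < a * b := mul_pos ha hb
  -- `η` is the proportion of edges that may be removed.
  set η : ℝ := ε ^ (a * b) / (2 * c + a ^ 2 + b ^ 2) with hη
  have hden : (0 : ℝ) < 2 * c + a ^ 2 + b ^ 2 := by positivity
  have hη0 : 0 < η := by positivity
  -- From `n₀` vertices on, the density of ordered triangles is at most `μ`.
  set μ : ℝ := min η (triangleRemovalBound η / 2) with hμ
  have hρ := triangleRemovalBound_pos hη0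
  have hμ0 : 0 < μ := lt_min hη0 (by positivity)
  set n₀ : ℝ := (c + a ^ 2 + b ^ 2) / μ ^ (a * b) with hn₀
  have hn₀0 : 0 ≤ n₀ := by positivity
  refine ⟨n₀ ^ 3, fun W _ G hF => ?_⟩
  set n : ℝ := ((Fintype.card W : ℕ) : ℝ) with hn
  have hn0 : 0 ≤ n := Nat.cast_nonneg _
  have htriv : (#(markedTriangles G G) : ℝ) ≤ n ^ 3 := by
    have : #(markedTriangles G G) ≤ Fintype.card W ^ 3 := by
      refine (card_le_univ _).trans (le_of_eq ?_)
      simp [pow_three]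
    rw [hn]
    exact_mod_cast this
  have hTG : (#(G.cliqueFinset 3) : ℝ) ≤ #(markedTriangles G G) := by
    exact_mod_cast card_cliqueFinset_le_card_markedTriangles (by simp)
  have hpow0 : 0 ≤ ε * n ^ ((3 : ℝ) - 1 / ((a : ℝ) * b)) := by positivity
  rcases lt_or_ge n n₀ with hlt | hge
  · have : n ^ 3 ≤ n₀ ^ 3 := by gcongr
    linarith
  rcases isEmpty_or_nonempty W with hW | hW
  · have : n ^ 3 = 0 := by simp [hn]
    have : (0 : ℝ) ≤ n₀ ^ 3 := by positivity
    linarith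
  have hnpos : 0 < n := by rw [hn]; exact_mod_cast Fintype.card_pos
  -- The trivial bound on the number of edges shows that the triangle density is at most `μ`.
  have hτ : (#(markedTriangles G G) : ℝ) / n ^ 3 ≤ μ := by
    have h1 := card_mul_density_pow_le (le_refl G) ha hb hF
    rw [← hn] at h1
    have h2 : (#{e : W × W | G.Adj e.1 e.2} : ℝ) / n ^ 2 ≤ 1 := by
      rw [div_le_one (by positivity), hn]
      have : #{e : W × W | G.Adj e.1 e.2} ≤ Fintype.card W ^ 2 := by
        refine (card_le_univ _).trans (le_of_eq ?_)
        simp [sq]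
      exact_mod_cast this
    have h3 : (#(markedTriangles G G) : ℝ) / n ^ 3 ≤ 1 := by
      rwa [div_le_one (by positivity)]
    refine le_of_pow_le_pow_left₀ hab.ne' hμ0.le ?_
    refine le_of_mul_le_mul_left (h1.trans ?_) hnpos
    calc _ ≤ (c : ℝ) * 1 + (a ^ 2 + b ^ 2) * 1 := by gcongr
      _ = n₀ * μ ^ (a * b) := by rw [hn₀]; field_simp; ring
      _ ≤ _ := by gcongr
  have hremoval : (#(G.cliqueFinset 3) : ℝ) < triangleRemovalBound η * Fintype.card W ^ 3 := by
    rw [div_le_iff₀ (by positivity)] at hτ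
    have h1 : μ < triangleRemovalBound η := (min_le_right _ _).trans_lt (half_lt_self hρ)
    calc _ ≤ _ := hTG
      _ ≤ _ := hτ
      _ < triangleRemovalBound η * n ^ 3 := by gcongr
  obtain ⟨H, hHG, hdec, hcard, hfree⟩ := triangle_removal hremoval
  obtain rfl : hdec = fun _ _ => propDecidable _ := Subsingleton.elim _ _
  obtain ⟨G', hG'⟩ : ∃ G', G' = G \ H := ⟨_, rfl⟩
  have hsd : G \ G' = H := by rw [hG', sdiff_sdiff_eq_self hHG]
  have hle : G' ≤ G := hG' ▸ sdiff_le
  have hT : (#(G.cliqueFinset 3) : ℝ) ≤ #(markedTriangles G G') := by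
    exact_mod_cast card_cliqueFinset_le_card_markedTriangles (by rwa [hsd])
  have hmono : (#(markedTriangles G G') : ℝ) ≤ #(markedTriangles G G) := by
    have : markedTriangles G G' ⊆ markedTriangles G G := by
      rintro ⟨x, y, z⟩ h
      rw [mem_markedTriangles] at h ⊢
      exact ⟨hle h.1, h.2⟩
    exact_mod_cast card_le_card this
  have hmain := card_mul_density_pow_le hle ha hb hF
  rw [← hn] at hmain
  set τ : ℝ := (#(markedTriangles G G') : ℝ) / n ^ 3 with hτdef
  have hτ0 : 0 ≤ τ := by positivity
  -- The smallness of `τ` controls the error from the non-injective homomorphisms.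
  have hτη : τ ≤ η := (div_le_div_of_nonneg_right hmono (by positivity)).trans
    (hτ.trans (min_le_left _ _))
  have hE : (#{e : W × W | G'.Adj e.1 e.2} : ℝ) / n ^ 2 ≤ 2 * η := by
    rw [div_le_iff₀ (by positivity)]
    rw [card_filter_adj_sdiff hHG hG']
    have h2 : ((#G.edgeFinset : ℝ) - #H.edgeFinset) < η * n ^ 2 := by
      rw [hn]
      convert hcard using 3
      push_cast; rfl
    linarith
  have hpow : n * τ ^ (a * b) ≤ ε ^ (a * b) := by
    calc _ ≤ _ := hmain
      _ ≤ (c : ℝ) * (2 * η) + (a ^ 2 + b ^ 2) * η := by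
        gcongr
      _ = _ := by rw [hη]; field_simp; ring
  have hτle : τ ≤ ε * n ^ (-(1 / ((a : ℝ) * b))) := by
    refine le_of_pow_le_pow_left₀ hab.ne' (by positivity) ?_
    rw [mul_pow, ← Real.rpow_natCast (n ^ _), ← Real.rpow_mul hnpos.le]
    have : -(1 / ((a : ℝ) * b)) * ((a * b : ℕ) : ℝ) = -1 := by
      have : (a : ℝ) ≠ 0 := by positivity
      have : (b : ℝ) ≠ 0 := by positivity
      push_cast; field_simp
    rw [this, Real.rpow_neg_one, ← div_eq_mul_inv, le_div_iff₀ hnpos, mul_comm]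
    exact hpow
  calc (#(G.cliqueFinset 3) : ℝ) ≤ τ * n ^ 3 := by
        rw [hτdef, div_mul_cancel₀ _ (by positivity)]; exact hT
    _ ≤ (ε * n ^ (-(1 / ((a : ℝ) * b)))) * n ^ 3 := by gcongr
    _ = ε * n ^ ((3 : ℝ) - 1 / ((a : ℝ) * b)) := by
        rw [mul_assoc, ← Real.rpow_natCast n 3, ← Real.rpow_add hnpos]
        congr 2
        push_cast; ring
    _ ≤ _ := le_add_of_nonneg_right (by positivity)

end Triangles

/-! ### Triangles in graphs with a given number of edges -/

section EdgeBound

open Classical Finset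

variable {V : Type*} [Fintype V]

/-- Splitting the triangles of `G` according to whether they have a vertex of degree below `D`. -/
theorem card_triangles_le_add_induce (G : SimpleGraph V) {D : ℝ} (hD : 0 ≤ D) {H : Set V}
    (hH : ∀ v, v ∈ H ↔ D ≤ G.degree v) :
    (#(G.cliqueFinset 3) : ℝ) ≤ 2 * #G.edgeFinset * D +
      #((G.induce H).cliqueFinset 3) := by
  have hsplit : G.cliqueFinset 3 ⊆
      ((univ.filter fun v => v ∉ H).biUnion fun v =>
        (G.neighborFinset v ×ˢ G.neighborFinset v).image fun p => {v, p.1, p.2}) ∪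
      ((G.induce H).cliqueFinset 3).image fun s => s.map (Function.Embedding.subtype _) := by
    intro s hs
    rw [mem_cliqueFinset_iff] at hs
    rw [mem_union]
    by_cases h : ∀ v ∈ s, v ∈ H
    · right
      refine mem_image.2 ⟨s.subtype (· ∈ H), ?_, ?_⟩
      · rw [mem_cliqueFinset_iff]
        refine ⟨?_, ?_⟩
        · intro x hx y hy hxy
          exact hs.isClique (by simpa using hx) (by simpa using hy)
            (fun h' => hxy (Subtype.ext h'))
        · rw [card_subtype, filter_true_of_mem h, hs.card_eq]
      · rw [subtype_map, filter_true_of_mem h]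
    · left
      push Not at h
      obtain ⟨v, hv, hvH⟩ := h
      have hcard : #(s.erase v) = 2 := by rw [card_erase_of_mem hv, hs.card_eq]
      obtain ⟨x, y, -, hxy⟩ := card_eq_two.1 hcard
      have hadj : ∀ u ∈ s.erase v, G.Adj v u := fun u hu =>
        hs.isClique hv (mem_of_mem_erase hu) (ne_of_mem_erase hu).symm
      refine mem_biUnion.2 ⟨v, by simpa using hvH, mem_image.2 ⟨(x, y), ?_, ?_⟩⟩
      · simp only [mem_product, mem_neighborFinset]
        exact ⟨hadj x (by simp [hxy]), hadj y (by simp [hxy])⟩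
      · rw [← insert_erase hv, hxy]
  have hlow : (#((univ.filter fun v => v ∉ H).biUnion fun v =>
      (G.neighborFinset v ×ˢ G.neighborFinset v).image fun p => ({v, p.1, p.2} : Finset V)) : ℝ) ≤
        2 * #G.edgeFinset * D := by
    calc _ ≤ ((∑ v ∈ univ.filter fun v => v ∉ H, G.degree v * G.degree v : ℕ) : ℝ) := by
          refine Nat.cast_le.2 (card_biUnion_le.trans (sum_le_sum fun v _ => ?_))
          refine card_image_le.trans (le_of_eq ?_)
          rw [card_product, card_neighborFinset_eq_degree]
      _ ≤ ∑ v ∈ univ.filter fun v => v ∉ H, (G.degree v : ℝ) * D := by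
          push_cast
          refine sum_le_sum fun v hv => ?_
          have : (G.degree v : ℝ) < D := by simpa [hH] using hv
          gcongr
      _ ≤ ∑ v, (G.degree v : ℝ) * D := by
          refine (sum_le_sum fun v _ => ?_).trans
            (sum_le_sum_of_subset_of_nonneg (filter_subset _ _) fun v _ _ => by positivity)
          exact le_rfl
      _ = _ := by
          rw [← sum_mul]
          rw [show ∑ v, (G.degree v : ℝ) = 2 * #G.edgeFinset by
            exact_mod_cast G.sum_degrees_eq_twice_card_edges]
  calc (#(G.cliqueFinset 3) : ℝ) ≤ _ := Nat.cast_le.2 ((card_le_card hsplit).trans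
        (card_union_le _ _))
    _ ≤ _ := by
        push_cast
        exact add_le_add hlow (Nat.cast_le.2 card_image_le)

theorem mul_card_high_degree_le (G : SimpleGraph V) (D : ℝ) {H : Set V}
    (hH : ∀ v, v ∈ H ↔ D ≤ G.degree v) : D * Fintype.card H ≤ 2 * #G.edgeFinset := by
  have h1 := G.sum_degrees_eq_twice_card_edges
  calc D * Fintype.card H = ∑ v ∈ H.toFinset, D := by
        rw [sum_const, nsmul_eq_mul, mul_comm, Set.toFinset_card]
    _ ≤ ∑ v ∈ H.toFinset, (G.degree v : ℝ) :=
        sum_le_sum fun v hv => (hH v).1 (by simpa using hv)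
    _ ≤ ∑ v, (G.degree v : ℝ) :=
        sum_le_sum_of_subset_of_nonneg (subset_univ _) fun v _ _ => by positivity
    _ = 2 * #G.edgeFinset := by exact_mod_cast h1

/-- An upper bound on the number of triangles in terms of the number `m` of edges. The exponent is
`1 + x` with `x = (2 * t - 1) / (4 * t - 1)` and `t = a * b`; the degree threshold `m ^ x` balances
`m * m ^ x` against `(m / m ^ x) ^ (3 - 1 / t)`. -/
theorem eventually_card_triangles_le {a b c : ℕ} (ha : 0 < a) (hb : 0 < b) {η : ℝ} (hη : 0 < η) :
    ∀ᶠ m : ℕ in atTop, ∀ (W : Type) [Fintype W] (G : SimpleGraph W),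
      (completeTripartite a b c).Free G → #G.edgeFinset = m →
        (#(G.cliqueFinset 3) : ℝ) ≤
          η * (m : ℝ) ^ ((3 : ℝ) / 2 - 1 / (8 * (a : ℝ) * b - 2)) := by
  have ha1 : (1 : ℝ) ≤ a := by exact_mod_cast ha
  have hb1 : (1 : ℝ) ≤ b := by exact_mod_cast hb
  set t : ℝ := (a : ℝ) * b with ht
  have ht1 : 1 ≤ t := by nlinarith
  clear_value t
  set x : ℝ := (2 * t - 1) / (4 * t - 1) with hx
  clear_value x
  have h4t : 0 < 4 * t - 1 := by linarith
  have hx0 : 0 ≤ x := hx ▸ div_nonneg (by linarith) h4t.le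
  have hexp : (3 : ℝ) / 2 - 1 / (8 * (a : ℝ) * b - 2) = 1 + x := by
    have h8 : 8 * (a : ℝ) * b - 2 = 2 * (4 * t - 1) := by rw [ht]; ring
    rw [h8, hx]
    field_simp
    ring
  have hexp' : (1 - x) * (3 - 1 / t) = 1 + x := by
    have hne : 4 * t - 1 ≠ 0 := h4t.ne'
    have ht0 : t ≠ 0 := by positivity
    have h1x : 1 - x = 2 * t / (4 * t - 1) := by
      rw [hx, eq_div_iff hne, sub_mul, div_mul_cancel₀ _ hne]
      ring
    have h3t : 3 - 1 / t = (3 * t - 1) / t := by rw [sub_div, mul_div_cancel_right₀ _ ht0]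
    have h1x' : 1 + x = 2 * (3 * t - 1) / (4 * t - 1) := by
      rw [hx, eq_div_iff hne, add_mul, div_mul_cancel₀ _ hne]
      ring
    rw [h1x, h1x', h3t, div_mul_div_comm, div_eq_div_iff (mul_ne_zero hne ht0) hne]
    ring
  have he0 : 0 ≤ 3 - 1 / t := by
    have : 1 / t ≤ 1 := by rw [div_le_one (by linarith)]; exact ht1
    linarith
  rw [hexp]
  -- With the threshold `δ * m ^ x`, the triangles with a vertex of low degree, the main term for the
  -- others and the additive constant `C` each contribute at most `η / 3 * m ^ (1 + x)`.
  set δ : ℝ := η / 6 with hδ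
  have hδ0 : 0 < δ := by positivity
  set ε : ℝ := η / 3 / (2 / δ) ^ (3 - 1 / t) with hε
  have hε0 : 0 < ε := by positivity
  obtain ⟨C, hC⟩ := card_triangles_le_of_free (c := c) ha hb hε0
  have hlim : Tendsto (fun m : ℕ => η / 3 * (m : ℝ) ^ (1 + x)) atTop atTop :=
    ((tendsto_rpow_atTop (by linarith)).comp tendsto_natCast_atTop_atTop).const_mul_atTop
      (by positivity)
  filter_upwards [hlim.eventually_ge_atTop C, eventually_gt_atTop 0] with m hmC hm0 W _ G hF hm
  have hm0' : (0 : ℝ) < m := by exact_mod_cast hm0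
  set D : ℝ := δ * (m : ℝ) ^ x with hD
  have hD0 : 0 < D := by positivity
  obtain ⟨H, hH⟩ : ∃ H : Set W, ∀ v, v ∈ H ↔ D ≤ G.degree v := ⟨{v | D ≤ G.degree v}, by simp⟩
  have h1 := card_triangles_le_add_induce G hD0.le hH
  have h2 := mul_card_high_degree_le G D hH
  have h3 : (#((G.induce H).cliqueFinset 3) : ℝ) ≤
      ε * (Fintype.card H : ℝ) ^ (3 - 1 / ((a : ℝ) * b)) + C := by
    convert hC _ (G.induce H) (fun h => hF (h.trans (Embedding.induce _).isContained))
  rw [← ht] at h3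
  rw [hm] at h1 h2
  rw [← le_div_iff₀' hD0] at h2
  have h4 : (2 : ℝ) * m / D = 2 / δ * (m : ℝ) ^ (1 - x) := by
    rw [hD, Real.rpow_sub hm0', Real.rpow_one]
    field_simp
  rw [h4] at h2
  have h5 : ε * (Fintype.card H : ℝ) ^ (3 - 1 / t) ≤
      η / 3 * (m : ℝ) ^ (1 + x) := by
    calc _ ≤ ε * (2 / δ * (m : ℝ) ^ (1 - x)) ^ (3 - 1 / t) := by gcongr
      _ = _ := by
        rw [Real.mul_rpow (by positivity) (by positivity), ← Real.rpow_mul hm0'.le, hexp',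
          ← mul_assoc, hε, div_mul_cancel₀ _ (by positivity)]
  have h6 : 2 * (m : ℝ) * D = η / 3 * (m : ℝ) ^ (1 + x) := by
    rw [hD, Real.rpow_add hm0', Real.rpow_one, hδ]
    ring
  linarith

end EdgeBound

/-! ### The deletion method for a random set of edges -/

section Averaging

open Classical Finset

/-- Double counting of the pairs `A x ⊆ S` with `x ∈ X` and `S` an `m`-element subset of `U`. -/
theorem sum_powersetCard_card_filter_subset {ι γ : Type*} [DecidableEq γ] (U : Finset γ) (m j : ℕ) (hj : j ≤ m)
    (X : Finset ι) (A : ι → Finset γ) (hAU : ∀ x ∈ X, A x ⊆ U) (hA : ∀ x ∈ X, #(A x) = j) :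
    ∑ S ∈ powersetCard m U, #{x ∈ X | A x ⊆ S} = #X * (#U - j).choose (m - j) := by
  simp_rw [card_filter]
  rw [sum_comm, ← smul_eq_mul, ← sum_const]
  refine sum_congr rfl fun x hx => ?_
  rw [← card_filter, ← hA x hx]
  exact card_filter_powersetCard_subset _ _ _ (hAU x hx) (by rw [hA x hx]; exact hj)

variable {V : Type*} [Fintype V]

/-- The number of triangles of `G`. -/
noncomputable def numTriangles (G : SimpleGraph V) : ℕ := #(G.cliqueFinset 3)

theorem numTriangles_fromEdgeSet (S : Finset (Sym2 V)) :
    numTriangles (fromEdgeSet (S : Set (Sym2 V))) =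
      #{s ∈ powersetCard 3 (univ : Finset V) | s.offDiag.image Sym2.mk.uncurry ⊆ S} := by
  generalize hG : fromEdgeSet (S : Set (Sym2 V)) = G
  rw [numTriangles]
  congr 1
  ext s
  rw [mem_cliqueFinset_iff, mem_filter, mem_powersetCard, isNClique_iff, and_comm]
  refine and_congr (by simp) ?_
  simp only [isClique_iff, Set.Pairwise, ← hG, fromEdgeSet_adj, image_subset_iff, Prod.forall,
    mem_offDiag, mem_coe, Function.uncurry]
  exact ⟨fun h x y hxy => (h hxy.1 hxy.2.1 hxy.2.2).1,
    fun h x hx y hy hxy => ⟨h x y ⟨hx, hy, hxy⟩, hxy⟩⟩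

/-- Deleting one edge from each copy of `F` leaves an `F`-free graph, and each deleted edge destroys
at most `|V|` triangles. -/
theorem exists_free_numTriangles_le {β : Type*} [Fintype β] (F : SimpleGraph β) {p q : β}
    (hpq : F.Adj p q) (G : SimpleGraph V) :
    ∃ H ≤ G, F.Free H ∧ numTriangles G ≤ numTriangles H +
      Fintype.card V * #{φ : β ↪ V | F ≤ G.comap φ} := by
  set Φ : Finset (β ↪ V) := {φ : β ↪ V | F ≤ G.comap φ} with hΦ
  let R : Finset (Sym2 V) := Φ.image fun φ => s(φ p, φ q)
  have hHG : G.deleteEdges (R : Set (Sym2 V)) ≤ G := deleteEdges_le _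
  refine ⟨G.deleteEdges (R : Set (Sym2 V)), hHG, ?_, ?_⟩
  · rw [Free, isContained_iff_exists_le_comap]
    rintro ⟨φ, hφ⟩
    have h1 : φ ∈ Φ := by
      rw [hΦ, mem_filter]
      exact ⟨mem_univ _, hφ.trans (comap_monotone φ hHG)⟩
    have h2 := hφ hpq
    rw [comap_adj, deleteEdges_adj] at h2
    exact h2.2 (mem_coe.2 (mem_image_of_mem _ h1))
  · generalize hH : G.deleteEdges (R : Set (Sym2 V)) = H
    have hsub : G.cliqueFinset 3 ⊆ H.cliqueFinset 3 ∪
        ((univ : Finset V) ×ˢ Φ).image fun t => {t.2 p, t.2 q, t.1} := by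
      intro s hs
      rw [mem_cliqueFinset_iff, is3Clique_iff] at hs
      obtain ⟨x, y, z, hxy, hxz, hyz, rfl⟩ := hs
      have hkill : ∀ u v w : V, s(u, v) ∈ R → {u, v, w} ∈
          ((univ : Finset V) ×ˢ Φ).image fun t => ({t.2 p, t.2 q, t.1} : Finset V) := by
        intro u v w h
        obtain ⟨φ, hφ, h⟩ := mem_image.1 h
        refine mem_image.2 ⟨(w, φ), by simpa using hφ, ?_⟩
        rcases Sym2.eq_iff.1 h with ⟨rfl, rfl⟩ | ⟨rfl, rfl⟩
        · rfl
        · exact insert_comm _ _ _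
      rw [mem_union]
      by_cases h1 : s(x, y) ∈ R
      · exact Or.inr (hkill x y z h1)
      by_cases h2 : s(x, z) ∈ R
      · right
        rw [pair_comm y z]
        exact hkill x z y h2
      by_cases h3 : s(y, z) ∈ R
      · right
        rw [insert_comm x y, pair_comm x z]
        exact hkill y z x h3
      left
      rw [mem_cliqueFinset_iff, is3Clique_triple_iff]
      simp only [← hH, deleteEdges_adj, mem_coe]
      exact ⟨⟨hxy, h1⟩, ⟨hxz, h2⟩, ⟨hyz, h3⟩⟩
    refine (card_le_card hsub).trans ((card_union_le _ _).trans (Nat.add_le_add_left ?_ _))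
    refine card_image_le.trans (le_of_eq ?_)
    rw [card_product, card_univ]

/-- The deletion method, applied to a uniformly random set of `m` edges of the complete graph. The
hypothesis says that the expected number of triangles is at least twice the expected number of
triangles destroyed. -/
theorem exists_free_card_edgeFinset_le {β : Type*} [Fintype β] (F : SimpleGraph β) {p q : β}
    (hpq : F.Adj p q) {n m N : ℕ} (hn : Fintype.card V = n)
    (hN : N = n.choose 2) (hm3 : 3 ≤ m) (hm : #F.edgeFinset ≤ m)
    (hmN : m ≤ N)
    (hbound : 2 * (n ^ (Fintype.card β + 1) * (N - #F.edgeFinset).choose (m - #F.edgeFinset)) ≤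
      n.choose 3 * (N - 3).choose (m - 3)) :
    ∃ G : SimpleGraph (V), F.Free G ∧ #G.edgeFinset ≤ m ∧
      n.choose 3 * (N - 3).choose (m - 3) ≤ 2 * (N.choose m * numTriangles G) := by
  set U : Finset (Sym2 V) := (⊤ : SimpleGraph (V)).edgeFinset with hU
  have hUcard : #U = N := by rw [hU, hN, card_edgeFinset_top_eq_card_choose_two, hn]
  choose H hHG hfree hcard using fun S : Finset (Sym2 V) =>
    exists_free_numTriangles_le F hpq (fromEdgeSet (S : Set (Sym2 V)))
  have hT : ∑ S ∈ powersetCard m U,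
      numTriangles (fromEdgeSet (S : Set (Sym2 V))) =
        n.choose 3 * (N - 3).choose (m - 3) := by
    simp_rw [numTriangles_fromEdgeSet]
    rw [sum_powersetCard_card_filter_subset U m 3 hm3, card_powersetCard, hUcard, card_univ,
      hn]
    · intro s _ e he
      obtain ⟨⟨x, y⟩, hxy, rfl⟩ := mem_image.1 he
      simpa [hU] using (mem_offDiag.1 hxy).2.2
    · intro s hs
      rw [Sym2.card_image_offDiag, (mem_powersetCard.1 hs).2]
      rfl
  have hFsum : ∑ S ∈ powersetCard m U,
      #{φ : β ↪ V | F ≤ (fromEdgeSet (S : Set (Sym2 V))).comap φ} ≤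
        n ^ Fintype.card β * (N - #F.edgeFinset).choose (m - #F.edgeFinset) := by
    have hiff : ∀ (S : Finset (Sym2 V)) (φ : β ↪ V),
        F ≤ (fromEdgeSet (S : Set (Sym2 V))).comap φ ↔
          F.edgeFinset.image (Sym2.map φ) ⊆ S := by
      intro S φ
      rw [image_subset_iff]
      constructor
      · intro h e he
        induction e with | _ x y =>
        have := h (mem_edgeFinset.1 he)
        rw [comap_adj, fromEdgeSet_adj] at this
        simpa using this.1
      · intro h x y hxy
        rw [comap_adj, fromEdgeSet_adj]
        exact ⟨by simpa using h s(x, y) (mem_edgeFinset.2 hxy), φ.injective.ne hxy.ne⟩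
    have hcount : ∀ S : Finset (Sym2 V),
        #{φ : β ↪ V | F ≤ (fromEdgeSet (S : Set (Sym2 V))).comap φ} =
          #((univ : Finset (β ↪ V)).filter fun φ : β ↪ V =>
            F.edgeFinset.image (Sym2.map φ) ⊆ S) := by
      intro S
      congr 1
      ext φ
      simp only [mem_filter, hiff]
    simp_rw [hcount]
    rw [sum_powersetCard_card_filter_subset U m _ hm, hUcard]
    · refine Nat.mul_le_mul_right _ ?_
      rw [card_univ, Fintype.card_embedding_eq, hn]
      exact Nat.descFactorial_le_pow _ _
    · intro φ _ e he
      obtain ⟨e', he', rfl⟩ := mem_image.1 he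
      clear he
      induction e' with | _ x y =>
      have hxy : F.Adj x y := by simpa using he'
      simpa [hU] using hxy.ne
    · intro φ _
      exact card_image_of_injective _ (Sym2.map.injective φ.injective)
  have hne : (powersetCard m U).Nonempty := powersetCard_nonempty.2 (hUcard ▸ hmN)
  -- Choose an edge set for which the graph left after the deletion has the most triangles, which
  -- is at least the average.
  obtain ⟨S, hS, hmax⟩ := exists_max_image (powersetCard m U) (fun S => numTriangles (H S)) hne
  refine ⟨H S, hfree S, ?_, ?_⟩
  · rw [← (mem_powersetCard.1 hS).2]
    refine card_le_card fun e he => ?_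
    have := edgeSet_mono (hHG S) (mem_edgeFinset.1 he)
    rw [edgeSet_fromEdgeSet] at this
    exact this.1
  · have hsum := sum_le_sum fun S (_ : S ∈ powersetCard m U) => hcard S
    rw [hT, sum_add_distrib, ← mul_sum, hn] at hsum
    have h1 := sum_le_card_nsmul _ _ _ hmax
    rw [card_powersetCard, hUcard, smul_eq_mul] at h1
    have h2 := Nat.mul_le_mul_left n hFsum
    rw [pow_succ'] at hbound
    rw [← mul_assoc n] at h2
    omega

end Averaging

/-! ### Padding to a prescribed number of edges -/

section Padding

open Classical Finset

variable {V : Type*} [Fintype V]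

theorem copyCount_top_three_eq_numTriangles (G : SimpleGraph V) :
    G.copyCount (⊤ : SimpleGraph (Fin 3)) = numTriangles G :=
  copyCount_top_three G

theorem Embedding.numTriangles_le {W : Type*} [Fintype W] {H : SimpleGraph V} {G : SimpleGraph W}
    (f : H ↪g G) : numTriangles H ≤ numTriangles G := by
  refine card_le_card_of_injOn (fun s => s.map f.toEmbedding) ?_
    (fun _ _ _ _ h => Finset.map_injective f.toEmbedding h)
  intro s hs
  rw [coe_cliqueFinset, mem_cliqueSet_iff, is3Clique_iff] at hs ⊢
  obtain ⟨x, y, z, hxy, hxz, hyz, rfl⟩ := hs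
  exact ⟨f x, f y, f z, f.map_rel_iff.2 hxy, f.map_rel_iff.2 hxz, f.map_rel_iff.2 hyz, by simp⟩

theorem card_edgeFinset_completeMultipartiteGraph_fin_three (s : Fin 3 → ℕ)
    {F : SimpleGraph (Σ i : Fin 3, Fin (s i))}
    (hF : F = completeMultipartiteGraph fun i => Fin (s i)) :
    #F.edgeFinset = s 0 * s 1 + s 1 * s 2 + s 2 * s 0 := by
  have h := card_filter_adj F
  have hadj : ∀ p q, F.Adj p q ↔ p.1 ≠ q.1 := fun p q => by rw [hF]; simp
  rw [card_filter, Fintype.sum_prod_type] at h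
  simp only [hadj, Fintype.sum_sigma, Fin.sum_univ_three] at h
  simp at h
  linarith

/-- A complete tripartite graph is connected and contains a triangle, so a copy of it in the disjoint
union of `H` with a bipartite graph lies in `H`. -/
theorem completeTripartite_free_sum {W : Type*} {a b c : ℕ} (ha : 0 < a) (hb : 0 < b) (hc : 0 < c)
    {V : Type*} {H : SimpleGraph V} {B : SimpleGraph W} (hH : (completeTripartite a b c).Free H)
    (hB : B.Colorable 2) : (completeTripartite a b c).Free (H ⊕g B) := by
  rintro ⟨f⟩
  have hpos : ∀ i : Fin 3, 0 < ![a, b, c] i := by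
    intro i
    fin_cases i <;> simp [ha, hb, hc]
  let v : Fin 3 → Σ i : Fin 3, Fin (![a, b, c] i) := fun i => ⟨i, 0, hpos i⟩
  have hside : ∀ p q, (completeTripartite a b c).Adj p q → (f p).isLeft = (f q).isLeft := by
    intro p q hpq
    have := f.toHom.map_adj hpq
    revert this
    change (H ⊕g B).Adj (f p) (f q) → _
    rcases f p with x | x <;> rcases f q with y | y <;> simp
  have hall : ∀ p, (f p).isLeft = (f (v 0)).isLeft := by
    intro p
    have h10 : (f (v 1)).isLeft = (f (v 0)).isLeft := hside _ _ (by simp [v])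
    by_cases hp : p.1 = 0
    · rw [← h10]
      exact hside _ _ (by simp [v, hp])
    · exact hside _ _ (by simpa [v] using hp)
  by_cases h0 : (f (v 0)).isLeft = true
  · choose g hg using fun p => Sum.isLeft_iff.1 ((hall p).trans h0)
    refine hH ⟨⟨⟨g, fun {p q} hpq => ?_⟩, fun p q hpq => f.injective ?_⟩⟩
    · have := f.toHom.map_adj hpq
      change (H ⊕g B).Adj (f p) (f q) at this
      rwa [hg, hg, sum_adj_inl] at this
    · change f p = f q
      rw [hg, hg]
      exact congrArg _ hpq
  · have hR : ∀ p, (f p).isRight = true := fun p => by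
      rw [← Sum.not_isLeft, hall p]
      simpa using h0
    choose g hg using fun p => Sum.isRight_iff.1 (hR p)
    obtain ⟨col⟩ := hB
    have hinj : Function.Injective fun i => col (g (v i)) := by
      intro i j hij
      by_contra hne
      have := f.toHom.map_adj (v := v i) (w := v j) (by simpa [v] using hne)
      change (H ⊕g B).Adj (f (v i)) (f (v j)) at this
      rw [hg, hg, sum_adj_inr] at this
      exact col.valid this hij
    simpa using Fintype.card_le_of_injective _ hinj

/-- Missing edges are supplied by a disjoint star. -/
theorem numTriangles_le_mex {V : Type} [Fintype V] {a b c m : ℕ} (ha : 0 < a) (hb : 0 < b)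
    (hc : 0 < c) {H : SimpleGraph V} (hH : (completeTripartite a b c).Free H)
    (hm : #H.edgeFinset ≤ m) :
    numTriangles H ≤ mex m (⊤ : SimpleGraph (Fin 3)) (completeTripartite a b c) := by
  set B := completeBipartiteGraph (Fin 1) (Fin (m - #H.edgeFinset)) with hB
  have hcol : B.Colorable 2 := by
    have := (CompleteBipartiteGraph.bicoloring (Fin 1) (Fin (m - #H.edgeFinset))).colorable
    simpa using this
  have hBcard : B.edgeSet.ncard = m - #H.edgeFinset := by
    rw [Set.ncard, hB, encard_edgeSet_completeBipartiteGraph]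
    rw [ENat.card_eq_coe_fintype_card, ENat.card_eq_coe_fintype_card, ← Nat.cast_mul,
      ENat.toNat_natCast]
    simp
  have hcard : (H ⊕g B).edgeSet.ncard = m := by
    rw [← Nat.card_coe_set_eq, Nat.card_congr edgeSetSumEquiv, Nat.card_sum, Nat.card_coe_set_eq,
      Nat.card_coe_set_eq, hBcard, ← coe_edgeFinset, Set.ncard_coe_finset]
    omega
  refine (Embedding.numTriangles_le (Embedding.sumInl (G := H) (H := B))).trans ?_
  rw [← copyCount_top_three_eq_numTriangles]
  exact (isGreatest_mex_completeTripartite m a b c ha hb hc).2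
    ⟨_, inferInstance, H ⊕g B, hcard, completeTripartite_free_sum ha hb hc hH hcol, rfl⟩

end Padding

/-! ### Ratios of binomial coefficients -/

section Binomial

/-- The number of `m`-subsets of an `N`-set containing a given `j`-set changes by a factor between
`(m - j) / N` and `m / N` when the given set is enlarged by one element. -/
theorem mul_choose_sub_succ_le {N m j : ℕ} (hj : j < m) (hmN : m ≤ N) :
    N * (N - (j + 1)).choose (m - (j + 1)) ≤ m * (N - j).choose (m - j) ∧
      (m - j) * (N - j).choose (m - j) ≤ N * (N - (j + 1)).choose (m - (j + 1)) := by
  have h := Nat.add_one_mul_choose_eq (N - (j + 1)) (m - (j + 1))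
  rw [show N - (j + 1) + 1 = N - j by omega, show m - (j + 1) + 1 = m - j by omega] at h
  generalize (N - (j + 1)).choose (m - (j + 1)) = x at *
  generalize (N - j).choose (m - j) = y at *
  constructor
  · obtain ⟨k, rfl⟩ := Nat.exists_eq_add_of_lt (lt_of_lt_of_le hj hmN)
    obtain ⟨l, rfl⟩ := Nat.exists_eq_add_of_lt hj
    have e1 : j + k + 1 - j = k + 1 := by omega
    have e2 : j + l + 1 - j = l + 1 := by omega
    rw [e1, e2] at h
    have hlk : l ≤ k := by omega
    refine Nat.le_of_mul_le_mul_left (c := k + 1) ?_ (by omega)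
    calc (k + 1) * ((j + k + 1) * x) = (j + k + 1) * ((k + 1) * x) := by ring
      _ = ((j + k + 1) * (l + 1)) * y := by rw [h]; ring
      _ ≤ ((k + 1) * (j + l + 1)) * y := by gcongr ?_ * y; nlinarith
      _ = _ := by ring
  · calc (m - j) * y = (N - j) * x := by rw [h]; ring
      _ ≤ N * x := by gcongr; omega

theorem pow_mul_choose_sub_le {N m i : ℕ} (j : ℕ) (hj : i + j ≤ m) (hmN : m ≤ N) :
    N ^ j * (N - (i + j)).choose (m - (i + j)) ≤ m ^ j * (N - i).choose (m - i) := by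
  induction j with
  | zero => simp
  | succ j ih =>
    have h := (mul_choose_sub_succ_le (j := i + j) (by omega) hmN).1
    calc N ^ (j + 1) * (N - (i + (j + 1))).choose (m - (i + (j + 1)))
        = N ^ j * (N * (N - (i + j + 1)).choose (m - (i + j + 1))) := by
          rw [← add_assoc]; ring
      _ ≤ N ^ j * (m * (N - (i + j)).choose (m - (i + j))) := by gcongr
      _ = m * (N ^ j * (N - (i + j)).choose (m - (i + j))) := by ring
      _ ≤ m * (m ^ j * (N - i).choose (m - i)) := Nat.mul_le_mul_left _ (ih (by omega))
      _ = _ := by ring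

theorem pow_three_mul_choose_le {N m : ℕ} (hm : 3 ≤ m) (hmN : m ≤ N) :
    (m - 2) ^ 3 * N.choose m ≤ N ^ 3 * (N - 3).choose (m - 3) := by
  have h0 := (mul_choose_sub_succ_le (j := 0) (by omega) hmN).2
  have h1 := (mul_choose_sub_succ_le (j := 1) (by omega) hmN).2
  have h2 := (mul_choose_sub_succ_le (j := 2) (by omega) hmN).2
  simp only [Nat.sub_zero, zero_add, Nat.reduceAdd] at h0 h1 h2
  calc (m - 2) ^ 3 * N.choose m = (m - 2) * ((m - 2) * ((m - 2) * N.choose m)) := by ring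
    _ ≤ (m - 2) * ((m - 2) * (m * N.choose m)) := by gcongr; omega
    _ ≤ (m - 2) * ((m - 2) * (N * (N - 1).choose (m - 1))) := by gcongr
    _ ≤ (m - 2) * ((m - 1) * (N * (N - 1).choose (m - 1))) := by gcongr; omega
    _ = (m - 2) * (N * ((m - 1) * (N - 1).choose (m - 1))) := by ring
    _ ≤ (m - 2) * (N * (N * (N - 2).choose (m - 2))) := by gcongr
    _ = N * (N * ((m - 2) * (N - 2).choose (m - 2))) := by ring
    _ ≤ N * (N * (N * (N - 3).choose (m - 3))) := by gcongr
    _ = _ := by ring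

end Binomial

/-! ### The lower bound -/

section LowerBound

theorem cube_le_twelve_mul_choose_three {n : ℕ} (hn : 6 ≤ n) : n ^ 3 ≤ 12 * n.choose 3 := by
  have h := Nat.descFactorial_eq_factorial_mul_choose n 3
  obtain ⟨k, rfl⟩ := Nat.exists_eq_add_of_le hn
  have e : (6 + k).descFactorial 3 = (4 + k) * ((5 + k) * (6 + k)) := by
    simp only [Nat.descFactorial, Nat.sub_zero, mul_one]
    congr 1
    · omega
    · congr 1
      omega
  rw [e, show Nat.factorial 3 = 6 from rfl] at h
  nlinarith

/-- With `e` edges and `v` vertices in the forbidden graph, and with at least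
`(96 * m) ^ ((e - 3) / (2 * e - v - 4))` vertices, few triangles are destroyed by the deletion. Here
`k = e - 3` and `d = 2 * e - v - 4`. -/
theorem two_mul_pow_mul_choose_le {n m N v k d : ℕ} (hn : 6 ≤ n) (hN : n ^ 2 ≤ 4 * N)
    (hd : 2 * k + 2 = d + v) (hk : 0 < k) (hm : k + 3 ≤ m) (hmN : m ≤ N)
    (hnm : (96 * m) ^ k ≤ n ^ d) :
    2 * (n ^ (v + 1) * (N - (k + 3)).choose (m - (k + 3))) ≤
      n.choose 3 * (N - 3).choose (m - 3) := by
  have h1 := pow_mul_choose_sub_le (i := 3) k (by omega) hmN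
  rw [add_comm 3 k] at h1
  have h3 := cube_le_twelve_mul_choose_three hn
  have hNpos : 0 < N := by omega
  have h24 : 24 ≤ 24 ^ k := Nat.le_self_pow hk.ne' 24
  have key : 24 * 4 ^ k * n ^ (v + 1) * m ^ k ≤ 12 * 4 ^ k * (n.choose 3 * N ^ k) := by
    calc 24 * 4 ^ k * n ^ (v + 1) * m ^ k ≤ 24 ^ k * 4 ^ k * n ^ (v + 1) * m ^ k := by gcongr
      _ = (96 * m) ^ k * n ^ (v + 1) := by
        rw [show 96 * m = 24 * 4 * m by ring, mul_pow, mul_pow]; ring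
      _ ≤ n ^ d * n ^ (v + 1) := by gcongr
      _ = n ^ 3 * (n ^ 2) ^ k := by
        rw [← pow_add, ← pow_mul, ← pow_add]; congr 1; omega
      _ ≤ (12 * n.choose 3) * (4 * N) ^ k := by gcongr
      _ = _ := by rw [mul_pow]; ring
  have key' : 2 * n ^ (v + 1) * m ^ k ≤ n.choose 3 * N ^ k := by
    refine Nat.le_of_mul_le_mul_left (c := 12 * 4 ^ k) ?_ (by positivity)
    calc _ = 24 * 4 ^ k * n ^ (v + 1) * m ^ k := by ring
      _ ≤ _ := key
  refine Nat.le_of_mul_le_mul_left (c := N ^ k) ?_ (by positivity)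
  calc N ^ k * (2 * (n ^ (v + 1) * (N - (k + 3)).choose (m - (k + 3))))
      = 2 * n ^ (v + 1) * (N ^ k * (N - (k + 3)).choose (m - (k + 3))) := by ring
    _ ≤ 2 * n ^ (v + 1) * (m ^ k * (N - 3).choose (m - 3)) := by gcongr
    _ = 2 * n ^ (v + 1) * m ^ k * (N - 3).choose (m - 3) := by ring
    _ ≤ n.choose 3 * N ^ k * (N - 3).choose (m - 3) := by gcongr
    _ = _ := by ring

/-- The deletion method with explicit constants. -/
theorem cube_le_mul_mex {a b c : ℕ} (ha : 0 < a) (hb : 0 < b) (hc : 0 < c) {n m k d : ℕ}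
    (he : a * b + b * c + c * a = k + 3) (hd : 2 * k + 2 = d + (a + b + c)) (hk : 0 < k)
    (hm : k + 3 ≤ m) (hm4 : 4 ≤ m) (hnm2 : 96 * m ≤ n ^ 2) (hnm : (96 * m) ^ k ≤ n ^ d) :
    m ^ 3 ≤ 24 * (n ^ 3 * mex m (⊤ : SimpleGraph (Fin 3)) (completeTripartite a b c)) := by
  classical
  have hn : 6 ≤ n := by
    by_contra! h
    nlinarith
  obtain ⟨N, hN⟩ : ∃ N, N = n.choose 2 := ⟨_, rfl⟩
  have h2N : 2 * N = n * (n - 1) := by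
    rw [hN, Nat.choose_two_right, Nat.mul_div_cancel' (Nat.even_mul_pred_self n).two_dvd]
  have hNlow : n ^ 2 ≤ 4 * N := by
    obtain ⟨l, rfl⟩ := Nat.exists_eq_add_of_le hn
    rw [show 6 + l - 1 = 5 + l by omega] at h2N
    nlinarith
  have hNup : 2 * N ≤ n ^ 2 := by
    rw [h2N, sq]
    exact Nat.mul_le_mul_left _ (Nat.sub_le _ _)
  have hmN : m ≤ N := by omega
  obtain ⟨F, hF⟩ : ∃ F, F = completeTripartite a b c := ⟨_, rfl⟩
  have hFcard : F.edgeFinset.card = k + 3 := by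
    rw [← he]
    exact card_edgeFinset_completeMultipartiteGraph_fin_three ![a, b, c] hF
  have hv : Fintype.card (Σ i : Fin 3, Fin (![a, b, c] i)) = a + b + c := by
    simp [Fin.sum_univ_three]
  have hadj : F.Adj ⟨0, ⟨0, ha⟩⟩ ⟨1, ⟨0, hb⟩⟩ := by rw [hF]; simp
  obtain ⟨G, hfree, hGm, hG⟩ := exists_free_card_edgeFinset_le (V := Fin n) F hadj
    (Fintype.card_fin n) hN (by omega) (by rw [hFcard]; exact hm) hmN (by
      rw [hFcard, hv]
      exact two_mul_pow_mul_choose_le hn hNlow hd hk hm hmN hnm)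
  rw [hF] at hfree
  have hmex := numTriangles_le_mex ha hb hc hfree hGm
  set M := mex m (⊤ : SimpleGraph (Fin 3)) (completeTripartite a b c)
  have h3 := cube_le_twelve_mul_choose_three hn
  have hC := pow_three_mul_choose_le (by omega : 3 ≤ m) hmN
  have hC0 : 0 < N.choose m := Nat.choose_pos hmN
  have h1 : n.choose 3 * (m - 2) ^ 3 ≤ 2 * (N ^ 3 * M) := by
    refine Nat.le_of_mul_le_mul_left (c := N.choose m) ?_ hC0
    calc N.choose m * (n.choose 3 * (m - 2) ^ 3) = n.choose 3 * ((m - 2) ^ 3 * N.choose m) := by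
          ring
      _ ≤ n.choose 3 * (N ^ 3 * (N - 3).choose (m - 3)) := by gcongr
      _ = N ^ 3 * (n.choose 3 * (N - 3).choose (m - 3)) := by ring
      _ ≤ N ^ 3 * (2 * (N.choose m * M)) := by
        exact Nat.mul_le_mul_left _ (hG.trans (by gcongr))
      _ = _ := by ring
  have hm2 : m ≤ 2 * (m - 2) := by omega
  refine Nat.le_of_mul_le_mul_left (c := n ^ 3) ?_ (by positivity)
  calc n ^ 3 * m ^ 3 ≤ (12 * n.choose 3) * (2 * (m - 2)) ^ 3 := by gcongr
    _ = 96 * (n.choose 3 * (m - 2) ^ 3) := by ring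
    _ ≤ 96 * (2 * (N ^ 3 * M)) := by gcongr
    _ = 24 * ((2 * N) ^ 3 * M) := by ring
    _ ≤ 24 * ((n ^ 2) ^ 3 * M) := by gcongr
    _ = _ := by ring

/-- The lower bound, with the exponent in the form `3 - 3 * γ` where `m ^ γ` is the order of magnitude
of the number of vertices. -/
theorem exists_eventually_mul_rpow_le_mex {a b c : ℕ} (ha : 0 < a) (hb : 0 < b) (hc : 0 < c)
    {k d : ℕ} (he : a * b + b * c + c * a = k + 3) (hd : 2 * k + 2 = d + (a + b + c))
    (hk : 0 < k) (hd0 : 0 < d) :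
    ∃ κ : ℝ, 0 < κ ∧ ∀ᶠ m : ℕ in atTop, κ * (m : ℝ) ^ ((3 : ℝ) - 3 * (k / d)) ≤
      (mex m (⊤ : SimpleGraph (Fin 3)) (completeTripartite a b c) : ℝ) := by
  set γ : ℝ := (k : ℝ) / d with hγ
  have hd0' : (0 : ℝ) < d := by exact_mod_cast hd0
  have hγ0 : 0 ≤ γ := by positivity
  have hγ1 : 1 ≤ γ * 2 := by
    rw [hγ, div_mul_eq_mul_div, le_div_iff₀ hd0', one_mul]
    exact_mod_cast (by omega : d ≤ k * 2)
  refine ⟨1 / (192 * (96 : ℝ) ^ (3 * γ)), by positivity, ?_⟩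
  filter_upwards [eventually_ge_atTop (k + 3), eventually_ge_atTop 4] with m hm hm4
  have hm0 : (0 : ℝ) < m := by exact_mod_cast (by omega : 0 < m)
  have hbase : (1 : ℝ) ≤ 96 * m := by
    have : (4 : ℝ) ≤ m := by exact_mod_cast hm4
    linarith
  have hbase0 : (0 : ℝ) ≤ 96 * m := by positivity
  set y : ℝ := (96 * (m : ℝ)) ^ γ with hy
  have hy1 : 1 ≤ y := Real.one_le_rpow hbase hγ0
  have hy0 : 0 < y := by linarith
  set n : ℕ := ⌈y⌉₊ with hn
  have hyn : y ≤ n := Nat.le_ceil y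
  have hn2y : (n : ℝ) ≤ 2 * y := by
    have := Nat.ceil_lt_add_one hy0.le
    rw [← hn] at this
    linarith
  have hnm2 : 96 * m ≤ n ^ 2 := by
    have : (96 : ℝ) * m ≤ (n : ℝ) ^ 2 := by
      calc (96 : ℝ) * m ≤ (96 * (m : ℝ)) ^ (γ * 2) := Real.self_le_rpow_of_one_le hbase hγ1
        _ = y ^ 2 := by rw [Real.rpow_mul hbase0, ← Real.rpow_natCast y]; norm_num [hy]
        _ ≤ _ := by gcongr
    exact_mod_cast this
  have hnm : (96 * m) ^ k ≤ n ^ d := by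
    have : ((96 : ℝ) * m) ^ k ≤ (n : ℝ) ^ d := by
      calc ((96 : ℝ) * m) ^ k = y ^ d := by
            rw [hy, ← Real.rpow_natCast, ← Real.rpow_natCast, ← Real.rpow_mul hbase0, hγ,
              div_mul_cancel₀ _ hd0'.ne']
        _ ≤ _ := by gcongr
    exact_mod_cast this
  have hmain := cube_le_mul_mex ha hb hc he hd hk hm hm4 hnm2 hnm
  set M := mex m (⊤ : SimpleGraph (Fin 3)) (completeTripartite a b c)
  have hmain' : (m : ℝ) ^ 3 ≤ 24 * ((n : ℝ) ^ 3 * M) := by exact_mod_cast hmain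
  have hy3 : y ^ 3 = (96 : ℝ) ^ (3 * γ) * (m : ℝ) ^ (3 * γ) := by
    rw [← Real.mul_rpow (by norm_num) hm0.le, mul_comm 3 γ, Real.rpow_mul hbase0,
      ← Real.rpow_natCast y]
    norm_num [hy]
  have hfin : (m : ℝ) ^ 3 ≤ 192 * (96 : ℝ) ^ (3 * γ) * (m : ℝ) ^ (3 * γ) * M := by
    calc (m : ℝ) ^ 3 ≤ 24 * ((n : ℝ) ^ 3 * M) := hmain'
      _ ≤ 24 * ((2 * y) ^ 3 * M) := by gcongr
      _ = 192 * y ^ 3 * M := by ring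
      _ = _ := by rw [hy3]; ring
  have hpow : (m : ℝ) ^ ((3 : ℝ) - 3 * γ) = (m : ℝ) ^ 3 / (m : ℝ) ^ (3 * γ) := by
    rw [Real.rpow_sub hm0, ← Real.rpow_natCast (m : ℝ) 3]
    norm_num
  rw [hpow, one_div_mul_eq_div, div_div, div_le_iff₀ (by positivity)]
  calc (m : ℝ) ^ 3 ≤ _ := hfin
    _ = _ := by ring

end LowerBound

end SimpleGraph

theorem mainTheorem11 (s₁ s₂ s₃ : ℕ) (h₁ : 0 < s₁) (h₁₂ : s₁ ≤ s₂) (h₂₃ : s₂ ≤ s₃) :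
    ((fun m : ℕ =>
        (mex m (⊤ : SimpleGraph (Fin 3)) (completeTripartite s₁ s₂ s₃) : ℝ))
      =o[atTop] fun m : ℕ => (m : ℝ) ^ ((3 : ℝ) / 2 - 1 / (8 * (s₁ : ℝ) * (s₂ : ℝ) - 2))) ∧
    ((3 : ℝ) / 2 <
        ((s₁ : ℝ) * s₂ + (s₂ : ℝ) * s₃ + (s₃ : ℝ) * s₁) / ((s₁ : ℝ) + s₂ + s₃) →
      (fun m : ℕ =>
          (m : ℝ) ^ ((3 : ℝ) / 2 -
            (3 * ((s₁ : ℝ) + s₂ + s₃) - 6) /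
              (4 * ((s₁ : ℝ) * s₂ + (s₂ : ℝ) * s₃ + (s₃ : ℝ) * s₁) -
                2 * ((s₁ : ℝ) + s₂ + s₃) - 8)))
        =O[atTop] fun m : ℕ =>
          (mex m (⊤ : SimpleGraph (Fin 3)) (completeTripartite s₁ s₂ s₃) : ℝ)) := by
  classical
  have h₂ : 0 < s₂ := by omega
  have h₃ : 0 < s₃ := by omega
  constructor
  · refine isLittleO_iff.2 fun η hη => ?_
    filter_upwards [SimpleGraph.eventually_card_triangles_le (c := s₃) h₁ h₂ hη] with m hm
    obtain ⟨V, _, G, hGm, hfree, hG⟩ := (isGreatest_mex_completeTripartite m s₁ s₂ s₃ h₁ h₂ h₃).1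
    rw [← hG, SimpleGraph.copyCount_top_three_eq_numTriangles, Real.norm_of_nonneg (Nat.cast_nonneg _),
      Real.norm_of_nonneg (by positivity)]
    refine hm V G hfree ?_
    rw [← hGm, ← SimpleGraph.coe_edgeFinset, Set.ncard_coe_finset]
  · intro h
    rw [lt_div_iff₀ (by positivity)] at h
    have hev : 3 * (s₁ + s₂ + s₃) < 2 * (s₁ * s₂ + s₂ * s₃ + s₃ * s₁) := by
      have : (3 : ℝ) * (s₁ + s₂ + s₃) < 2 * (s₁ * s₂ + s₂ * s₃ + s₃ * s₁) := by linarith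
      exact_mod_cast this
    obtain ⟨k, hk⟩ : ∃ k, s₁ * s₂ + s₂ * s₃ + s₃ * s₁ = k + 3 :=
      Nat.exists_eq_add_of_le' (by omega)
    obtain ⟨d, hd⟩ : ∃ d, 2 * k + 2 = d + (s₁ + s₂ + s₃) := Nat.exists_eq_add_of_le' (by omega)
    obtain ⟨κ, hκ, hle⟩ :=
      SimpleGraph.exists_eventually_mul_rpow_le_mex h₁ h₂ h₃ hk hd (by omega) (by omega)
    have hd0 : (0 : ℝ) < d := by exact_mod_cast (by omega : 0 < d)
    have hkR : (s₁ : ℝ) * s₂ + s₂ * s₃ + s₃ * s₁ = k + 3 := by exact_mod_cast hk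
    have hdR : (2 : ℝ) * k + 2 = d + (s₁ + s₂ + s₃) := by exact_mod_cast hd
    have hvR : (s₁ : ℝ) + s₂ + s₃ = 2 * k + 2 - d := by linarith
    have hexp : (3 : ℝ) / 2 - (3 * ((s₁ : ℝ) + s₂ + s₃) - 6) /
        (4 * ((s₁ : ℝ) * s₂ + (s₂ : ℝ) * s₃ + (s₃ : ℝ) * s₁) -
          2 * ((s₁ : ℝ) + s₂ + s₃) - 8) = 3 - 3 * (k / d) := by
      rw [hkR, hvR, show (4 : ℝ) * (k + 3) - 2 * (2 * k + 2 - d) - 8 = 2 * d by ring]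
      field_simp
      ring
    rw [hexp]
    refine IsBigO.of_bound (1 / κ) ?_
    filter_upwards [hle] with m hm
    rw [Real.norm_of_nonneg (by positivity), Real.norm_of_nonneg (Nat.cast_nonneg _),
      one_div_mul_eq_div, le_div_iff₀' hκ]
    exact hm
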